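/- Let $M$ be a smooth Riemannian manifold without boundary (not necessarily compact) with a smooth positive volume form $\mu$ of total volume $1$; gradients are taken with respect to the Riemannian metric and $\operatorname{div}$ with respect to $\mu$, i.e. $\int_M\varphi\operatorname{div}X\,\mu=-\int_M d\varphi(X)\,\mu$ for all smooth bounded $\varphi$ with bounded gradient. Equip the space $\mathrm{Vol}(M)$ of positive volume forms $\varrho=\rho\mu$ of finite total volume $m=\int_M\varrho$ with the metric $$\bar{\mathcal G}_\varrho(\dot\varrho,\dot\varrho)=\int_M\bigl(|\nabla\theta|^2+\xi^2\bigr)\varrho,\qquad \dot\rho=-\operatorname{div}(\rho\nabla\theta)+\xi\rho,\qquad \xi m=\int_M\theta\varrho,$$ where the potential $\theta$ represents the tangent vector $\dot\varrho$, and put $$H(\varrho,\theta)=\frac12\int_M|\nabla\theta|^2\varrho+\frac1{2m}\Bigl(\int_M\theta\varrho\Bigr)^2 .$$ Let $2\le k\le\infty$ and $a<b$. Consider paths $\varrho(t)=\rho(t)\mu$, $t\in[a,b]$, in $\mathrm{Vol}(M)$ with potentials $\theta(t)$ of $\dot\varrho(t)$, such that $\rho,\theta$ are $C^k$ on $[a,b]\times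 M$ and all integrals involved are finite and regular in time: $\rho,\partial_t\rho$ are bounded uniformly in $t$ by a $\mu$-integrable function, $\theta\rho$ and $|\nabla\theta|^2\rho$ are $\mu$-integrable, and $\int_M\theta\varrho$, $\int_M|\nabla\theta|^2\varrho$ are $C^1$ in $t$ (all automatic if $M$ is compact). Such a path is a geodesic of $\bar{\mathcal G}$ if it is a critical point of the energy $\frac12\int_a^b\bar{\mathcal G}_{\varrho}(\dot\varrho,\dot\varrho)\,dt$ under all variations through such paths with the same end points $\varrho(a),\varrho(b)$ that are $C^k$ in $(\varepsilon,t,x)$, with $m$, $\int_M\theta\varrho$ and $\int_M|\nabla\theta|^2\varrho$ being $C^1$ in $(\varepsilon,t)$. Then along every geodesic $H(\varrho(t),\theta(t))=H(\varrho(a),\theta(a))$ for all $t\in[a,b]$, and the total volume $m(t)=\int_M\varrho(t)$ evolves with constant acceleration equal to the energy level of the initial data: $$\dot m(t)=\int_M\theta(t)\varrho(t),\qquad \ddot m(t)=H(\varrho(a),\theta(a))\qquad(t\in[a,b]).$$ So $m$ moves like the height of an object in a constant gravity/buoyancy field: $$m(t)=m(a)+\dot m(a)(t-a)+\tfrac12H(\varrho(a),\theta(a))\,(t-a)^2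 .$$ -/

import Mathlib

open MeasureTheory Set Bundle
open scoped Manifold ContDiff ENNReal

noncomputable section

namespace UnbalancedTransport

variable (n : ℕ) {M : Type*} [TopologicalSpace M] [ChartedSpace (EuclideanSpace ℝ (Fin n)) M]

/-- `μ` is (the measure of) a smooth positive volume form on `M`: in every chart of the atlas it has
a smooth positive density with respect to Lebesgue measure. The Riemannian volume, whose density
is `√(det g)`, is the main example. -/
def IsVolumeForm [MeasurableSpace M] (μ : Measure M) : Prop :=
  ∀ e ∈ atlas (EuclideanSpace ℝ (Fin n)) M, ∃ f : EuclideanSpace ℝ (Fin n) → ℝ,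
    ContDiffOn ℝ ∞ f e.target ∧ (∀ y ∈ e.target, 0 < f y) ∧
    ∀ A : Set M, MeasurableSet A → A ⊆ e.source →
      μ A = ∫⁻ y in e '' A, ENNReal.ofReal (f y)

/-- The differential of a real function at `x`, as a linear form on the tangent space. -/
def differential (φ : M → ℝ) (x : M) :
    TangentSpace (𝓡 n) x →L[ℝ] ℝ :=
  mfderiv (𝓡 n) 𝓘(ℝ, ℝ) φ x

variable [RiemannianBundle (fun x : M => TangentSpace (𝓡 n) x)]

/-- The Riemannian gradient: `⟪∇φ(x), w⟫ = dφ(x) w` for all tangent vectors `w` at `x`. -/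
def grad (φ : M → ℝ) (x : M) : TangentSpace (𝓡 n) x :=
  haveI : FiniteDimensional ℝ (TangentSpace (𝓡 n) x) :=
    inferInstanceAs (FiniteDimensional ℝ (EuclideanSpace ℝ (Fin n)))
  haveI : CompleteSpace (TangentSpace (𝓡 n) x) := FiniteDimensional.complete ℝ _
  (InnerProductSpace.toDual ℝ (TangentSpace (𝓡 n) x)).symm (differential n φ x)

theorem inner_grad (φ : M → ℝ) (x : M) (w : TangentSpace (𝓡 n) x) :
    inner ℝ (grad n φ x) w = differential n φ x w := by
  have : FiniteDimensional ℝ (TangentSpace (𝓡 n) x) :=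
    inferInstanceAs (FiniteDimensional ℝ (EuclideanSpace ℝ (Fin n)))
  have : CompleteSpace (TangentSpace (𝓡 n) x) := FiniteDimensional.complete ℝ _
  exact InnerProductSpace.toDual_symm_apply

variable [MeasurableSpace M]

/-- `D` is the divergence, with respect to the volume `μ`, of the vector field `X`, and `X` has no
flux through infinity: `∫ φ D μ = - ∫ dφ(X) μ` for all smooth bounded `φ` with bounded gradient.
If `M` is compact (without boundary) these are all smooth functions, and for a `C¹` field `X` this
says that `D` is the usual divergence, `L_X μ = D μ`. -/
def HasDivergence (μ : Measure M) (X : ∀ x : M, TangentSpace (𝓡 n) x) (D : M → ℝ) : Prop :=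
  ∀ φ : M → ℝ, ContMDiff (𝓡 n) 𝓘(ℝ, ℝ) ∞ φ →
    (∃ C : ℝ, ∀ x, |φ x| ≤ C ∧ ‖grad n φ x‖ ≤ C) →
    ∫ x, φ x * D x ∂μ = - ∫ x, differential n φ x (X x) ∂μ

/-- Total volume `m = ∫ ρ μ` of the volume form `ϱ = ρ μ`. -/
def mass (μ : Measure M) (ρ : M → ℝ) : ℝ := ∫ x, ρ x ∂μ

/-- `∫ θ ϱ`. -/
def momentum (μ : Measure M) (ρ θ : M → ℝ) : ℝ := ∫ x, θ x * ρ x ∂μ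

/-- `∫ |∇θ|² ϱ`. -/
def kinetic (μ : Measure M) (ρ θ : M → ℝ) : ℝ :=
  ∫ x, ‖grad n θ x‖ ^ 2 * ρ x ∂μ

/-- The number `ξ` determined by `ξ m = ∫ θ ϱ`. -/
def scalingRate (μ : Measure M) (ρ θ : M → ℝ) : ℝ := momentum μ ρ θ / mass μ ρ

/-- The tangent vector `ρ'` at `ϱ = ρ μ` is the one represented by the potential `θ`:
`ρ' = - div (ρ ∇θ) + ξ ρ`, where `ξ m = ∫ θ ϱ`. Testing with the constant `1` shows that
`∫ ρ' μ = m ξ`, so that this fixes the additive constant in `θ`. -/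
def IsPotential (μ : Measure M) (ρ ρ' θ : M → ℝ) : Prop :=
  HasDivergence n μ (fun x => ρ x • grad n θ x) (fun x => scalingRate μ ρ θ * ρ x - ρ' x)

/-- The metric on volume forms, `∫ (|∇θ|² + ξ²) ϱ`, evaluated on the tangent vector at `ϱ = ρ μ`
represented by the potential `θ`. -/
def metricSq (μ : Measure M) (ρ θ : M → ℝ) : ℝ :=
  ∫ x, (‖grad n θ x‖ ^ 2 + scalingRate μ ρ θ ^ 2) * ρ x ∂μ

/-- The Hamiltonian `H(ϱ, θ) = ½ ∫ |∇θ|² ϱ + (1 / 2m) (∫ θ ϱ)²`. -/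
def hamiltonian (μ : Measure M) (ρ θ : M → ℝ) : ℝ :=
  1 / 2 * kinetic n μ ρ θ + 1 / (2 * mass μ ρ) * (momentum μ ρ θ) ^ 2

/-- Time derivative of a path of functions on `[a, b]` (one-sided at the end points). -/
def timeDeriv {M : Type*} (a b : ℝ) (ρ : ℝ → M → ℝ) (t : ℝ) (x : M) : ℝ :=
  derivWithin (fun s => ρ s x) (Icc a b) t

/-- A `C^k` path `t ↦ ϱ(t) = ρ(t) μ`, `t ∈ [a, b]`, of volume forms of finite total volume, together
with the potentials `θ(t)` representing its velocities. The last five conditions say that all the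
integrals involved are finite and depend regularly on time; for `k ≥ 2` they are automatic when `M`
is compact. -/
structure IsPath (k : ℕ∞) (μ : Measure M) (a b : ℝ) (ρ θ : ℝ → M → ℝ) : Prop where
  pos : ∀ t ∈ Icc a b, ∀ x, 0 < ρ t x
  contMDiffOn_density : ContMDiffOn (𝓘(ℝ, ℝ).prod (𝓡 n)) 𝓘(ℝ, ℝ) k
    (fun p : ℝ × M => ρ p.1 p.2) (Icc a b ×ˢ univ)
  contMDiffOn_potential : ContMDiffOn (𝓘(ℝ, ℝ).prod (𝓡 n)) 𝓘(ℝ, ℝ) k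
    (fun p : ℝ × M => θ p.1 p.2) (Icc a b ×ˢ univ)
  isPotential : ∀ t ∈ Icc a b, IsPotential n μ (ρ t) (timeDeriv a b ρ t) (θ t)
  dominated : ∃ B : M → ℝ, Integrable B μ ∧
    ∀ t ∈ Icc a b, ∀ x, |ρ t x| ≤ B x ∧ |timeDeriv a b ρ t x| ≤ B x
  integrable_momentum : ∀ t ∈ Icc a b, Integrable (fun x => θ t x * ρ t x) μ
  integrable_kinetic : ∀ t ∈ Icc a b,
    Integrable (fun x => ‖grad n (θ t) x‖ ^ 2 * ρ t x) μ
  contDiffOn_momentum : ContDiffOn ℝ 1 (fun t => momentum μ (ρ t) (θ t)) (Icc a b)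
  contDiffOn_kinetic : ContDiffOn ℝ 1 (fun t => kinetic n μ (ρ t) (θ t)) (Icc a b)

/-- A `C^k` variation `(R ε, Θ ε)`, `|ε| < δ`, of the path `(ρ, θ)` through paths of volume forms
with the same end points. -/
structure IsVariation (k : ℕ∞) (μ : Measure M) (a b : ℝ) (ρ θ : ℝ → M → ℝ)
    (δ : ℝ) (R Θ : ℝ → ℝ → M → ℝ) : Prop where
  isPath : ∀ ε ∈ Ioo (-δ) δ, IsPath n k μ a b (R ε) (Θ ε)
  density_zero : ∀ t ∈ Icc a b, R 0 t = ρ t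
  potential_zero : ∀ t ∈ Icc a b, Θ 0 t = θ t
  left_end : ∀ ε ∈ Ioo (-δ) δ, R ε a = ρ a
  right_end : ∀ ε ∈ Ioo (-δ) δ, R ε b = ρ b
  contMDiffOn_density : ContMDiffOn (𝓘(ℝ, ℝ × ℝ).prod (𝓡 n)) 𝓘(ℝ, ℝ) k
    (fun p : (ℝ × ℝ) × M => R p.1.1 p.1.2 p.2) ((Ioo (-δ) δ ×ˢ Icc a b) ×ˢ univ)
  contMDiffOn_potential : ContMDiffOn (𝓘(ℝ, ℝ × ℝ).prod (𝓡 n)) 𝓘(ℝ, ℝ) k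
    (fun p : (ℝ × ℝ) × M => Θ p.1.1 p.1.2 p.2) ((Ioo (-δ) δ ×ˢ Icc a b) ×ˢ univ)
  contDiffOn_mass : ContDiffOn ℝ 1
    (fun q : ℝ × ℝ => mass μ (R q.1 q.2)) (Ioo (-δ) δ ×ˢ Icc a b)
  contDiffOn_momentum : ContDiffOn ℝ 1
    (fun q : ℝ × ℝ => momentum μ (R q.1 q.2) (Θ q.1 q.2)) (Ioo (-δ) δ ×ˢ Icc a b)
  contDiffOn_kinetic : ContDiffOn ℝ 1
    (fun q : ℝ × ℝ => kinetic n μ (R q.1 q.2) (Θ q.1 q.2)) (Ioo (-δ) δ ×ˢ Icc a b)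

/-- The energy `½ ∫ₐᵇ ⟨ϱ', ϱ'⟩ dt` of a path of volume forms. -/
def energy (μ : Measure M) (a b : ℝ) (ρ θ : ℝ → M → ℝ) : ℝ :=
  1 / 2 * ∫ t in a..b, metricSq n μ (ρ t) (θ t)

/-- The path `ϱ = ρ μ` on `[a, b]`, with velocity potentials `θ`, is a geodesic of the space of
volume forms: it is a critical point of the energy among paths with the same end points. -/
def IsGeodesic (k : ℕ∞) (μ : Measure M) (a b : ℝ) (ρ θ : ℝ → M → ℝ) : Prop :=
  IsPath n k μ a b ρ θ ∧
    ∀ (δ : ℝ) (R Θ : ℝ → ℝ → M → ℝ), 0 < δ → IsVariation n k μ a b ρ θ δ R Θ →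
      HasDerivAt (fun ε => energy n μ a b (R ε) (Θ ε)) 0 0

end UnbalancedTransport

end

/-!
Along a path the Lagrangian is the Hamiltonian, as
`½ ∫ (|∇θ|² + ξ²) ϱ = ½ ∫ |∇θ|² ϱ + p² / (2m) = H` with `p = ∫ θ ϱ = ξ m`
(`metricSq_eq_two_mul_hamiltonian`), and testing the continuity equation against the constant `1`
gives `m' = p` (`IsPath.hasDerivWithinAt_mass`). So both claims about `H` follow from the
stationarity of the energy under two explicit families of variations, and the full geodesic
equations are not needed:

* Rescaling `ϱ ↦ e ^ (ε g) ϱ`, where `g` is a function of time, replaces the potential `θ` by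
  `θ + ε g'`. The first variation of the energy is `∫ (g H + g' p) dt`, whence `p' = H`
  (`IsGeodesic.derivWithin_momentum`).
* The change of time `τ = t + ε h` replaces `ϱ` by `ϱ(τ)` and `θ` by `τ' θ(τ)`. The first variation
  is `∫ (2 h' H + h H') dt = - ∫ h H' dt`, whence `H' = 0` (`IsGeodesic.derivWithin_hamiltonian`).

Both families are treated at once: `IsPath.reparam` and `IsPath.isVariation_reparam` show that they
are admissible, and `IsGeodesic.integral_eq_zero` computes the first variation. Then `m'' = p' = H`
is constant and `m` is quadratic in `t`.
-/

namespace UnbalancedTransport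

open Filter Topology

/-! ### Calculus on a closed interval -/

/-- Differentiation under the integral sign at `ε = 0`. The derivative in `ε` is only required at
interior times `t`; continuity of `F'` on the closed interval provides the dominating constant. -/
theorem hasDerivAt_integral_of_continuousOn {a b δ : ℝ} (hab : a ≤ b) (hδ : 0 < δ)
    {F F' : ℝ → ℝ → ℝ} (hF : ∀ ε ∈ Ioo (-δ) δ, ContinuousOn (F ε) (Icc a b))
    (hF' : ContinuousOn (fun q : ℝ × ℝ => F' q.1 q.2) (Ioo (-δ) δ ×ˢ Icc a b))
    (hd : ∀ ε ∈ Ioo (-δ) δ, ∀ t ∈ Ioo a b, HasDerivAt (fun ε => F ε t) (F' ε t) ε) :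
    HasDerivAt (fun ε => ∫ t in a..b, F ε t) (∫ t in a..b, F' 0 t) 0 := by
  have hsub : Icc (-(δ / 2)) (δ / 2) ⊆ Ioo (-δ) δ := fun x hx =>
    ⟨by linarith [hx.1], by linarith [hx.2]⟩
  obtain ⟨C, hC⟩ := ((isCompact_Icc (a := -(δ / 2)) (b := δ / 2)).prod
    (isCompact_Icc (a := a) (b := b))).exists_bound_of_continuousOn
      (hF'.mono (prod_mono hsub le_rfl))
  have h0 : (0 : ℝ) ∈ Ioo (-δ) δ := ⟨by linarith, hδ⟩
  have hmeas : ∀ G : ℝ → ℝ, ContinuousOn G (Icc a b) →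
      AEStronglyMeasurable G (volume.restrict (uIoc a b)) := fun G hG => by
    rw [uIoc_of_le hab]
    exact (hG.mono Ioc_subset_Icc_self).aestronglyMeasurable measurableSet_Ioc
  have hIoo : ∀ᵐ t : ℝ, t ∈ uIoc a b → t ∈ Ioo a b := by
    filter_upwards [compl_mem_ae_iff.2 (measure_singleton (μ := volume) b)] with t ht h
    rw [uIoc_of_le hab] at h
    exact ⟨h.1, lt_of_le_of_ne h.2 ht⟩
  refine (intervalIntegral.hasDerivAt_integral_of_dominated_loc_of_deriv_le
    (F := F) (F' := F') (bound := fun _ => C) (s := Ioo (-(δ / 2)) (δ / 2))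
    (Ioo_mem_nhds (by linarith) (by linarith)) ?_ ?_ ?_ ?_ ?_ ?_).2
  · filter_upwards [Ioo_mem_nhds h0.1 h0.2] with ε hε using hmeas _ (hF ε hε)
  · exact (hF 0 h0).intervalIntegrable_of_Icc hab
  · exact hmeas _ (hF'.comp (f := fun t => ((0 : ℝ), t)) (by fun_prop) fun t ht => ⟨h0, ht⟩)
  · filter_upwards [hIoo] with t ht h ε hε
    exact hC (ε, t) ⟨Ioo_subset_Icc_self hε, Ioo_subset_Icc_self (ht h)⟩
  · exact intervalIntegrable_const
  · filter_upwards [hIoo] with t ht h ε hε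
    exact hd ε (hsub (Ioo_subset_Icc_self hε)) t (ht h)

/-- The fundamental lemma of the calculus of variations. -/
theorem eq_zero_of_forall_integral_mul_eq_zero {a b : ℝ} (hab : a < b) {g : ℝ → ℝ}
    (hg : ContinuousOn g (Icc a b))
    (H : ∀ h : ℝ → ℝ, ContDiff ℝ ∞ h → HasCompactSupport h → tsupport h ⊆ Ioo a b →
      ∫ t in a..b, h t * g t = 0) : ∀ t ∈ Icc a b, g t = 0 := by
  have hae : ∀ᵐ t : ℝ, t ∈ Ioo a b → g t = 0 := by
    refine isOpen_Ioo.ae_eq_zero_of_integral_contDiff_smul_eq_zero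
      (f := g) ((hg.mono Ioo_subset_Icc_self).locallyIntegrableOn measurableSet_Ioo)
      fun h hs hc ht => ?_
    rw [← H h hs hc ht, intervalIntegral.integral_of_le hab.le, integral_Ioc_eq_integral_Ioo,
      setIntegral_eq_integral_of_forall_compl_eq_zero]
    · simp
    · intro t hn
      have : h t = 0 := image_eq_zero_of_notMem_tsupport fun hm => hn (ht hm)
      simp [this]
  have hae' : g =ᵐ[volume.restrict (Icc a b)] 0 := by
    rw [← restrict_Ioo_eq_restrict_Icc]
    exact (ae_restrict_iff' measurableSet_Ioo).2 hae
  exact Measure.eqOn_Icc_of_ae_eq volume hab.ne hae' hg continuousOn_const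

/-- A test function supported in the open interval vanishes at its end points. -/
theorem eq_zero_of_tsupport_subset_Ioo {a b : ℝ} {h : ℝ → ℝ} (hs : tsupport h ⊆ Ioo a b) :
    h a = 0 ∧ h b = 0 :=
  ⟨image_eq_zero_of_notMem_tsupport fun hm => (hs hm).1.false,
    image_eq_zero_of_notMem_tsupport fun hm => (hs hm).2.false⟩

theorem integral_mul_deriv_of_tsupport_subset {a b : ℝ} (hab : a < b) {p h : ℝ → ℝ}
    (hp : ContDiffOn ℝ 1 p (Icc a b)) (hh : ContDiff ℝ ∞ h) (hs : tsupport h ⊆ Ioo a b) :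
    ∫ t in a..b, p t * deriv h t = - ∫ t in a..b, h t * derivWithin p (Icc a b) t := by
  obtain ⟨ha, hb⟩ := eq_zero_of_tsupport_subset_Ioo hs
  have hu := uniqueDiffOn_Icc hab
  have := intervalIntegral.integral_mul_deriv_eq_deriv_mul_of_hasDerivWithinAt
    (a := a) (b := b) (u := p) (v := h) (u' := derivWithin p (Icc a b)) (v' := deriv h)
    (fun t ht => by
      rw [uIcc_of_le hab.le] at *
      exact ((hp.differentiableOn one_ne_zero) t ht).hasDerivWithinAt)
    (fun t _ => ((hh.differentiable (by simp)) t).hasDerivAt.hasDerivWithinAt)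
    ((hp.continuousOn_derivWithin hu le_rfl).intervalIntegrable_of_Icc hab.le)
    ((hh.continuous_deriv (by simp)).intervalIntegrable _ _)
  rw [this, ha, hb]
  simp [mul_comm]

theorem eqOn_of_hasDerivWithinAt_eq {a b : ℝ} {f g f' : ℝ → ℝ}
    (hf : ∀ t ∈ Icc a b, HasDerivWithinAt f (f' t) (Icc a b) t)
    (hg : ∀ t ∈ Icc a b, HasDerivWithinAt g (f' t) (Icc a b) t) (h : f a = g a) :
    ∀ t ∈ Icc a b, f t = g t := by
  intro t ht
  have := (convex_Icc a b).norm_image_sub_le_of_norm_hasDerivWithin_le (C := 0)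
    (f := f - g) (fun s hs => (hf s hs).sub (hg s hs)) (fun s _ => by simp)
    (left_mem_Icc.2 (ht.1.trans ht.2)) ht
  simp only [zero_mul, norm_le_zero_iff, Pi.sub_apply, h, sub_self, sub_zero] at this
  exact sub_eq_zero.1 this

section TimeDerivative

variable {M : Type*} {a b : ℝ} {ρ : ℝ → M → ℝ} {t : ℝ}

theorem hasDerivWithinAt_timeDeriv {k : ℕ∞} (hk : k ≠ 0) {x : M}
    (h : ContDiffOn ℝ k (fun s => ρ s x) (Icc a b)) (ht : t ∈ Icc a b) :
    HasDerivWithinAt (fun s => ρ s x) (timeDeriv a b ρ t x) (Icc a b) t :=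
  ((h.differentiableOn (by simpa using hk)) t ht).hasDerivWithinAt

end TimeDerivative

/-! ### Differentiation of integrals over the manifold -/

section DominatedDerivative

variable {M : Type*} [MeasurableSpace M] {μ : Measure M} {a b : ℝ} {f f' : ℝ → M → ℝ} {t : ℝ}

/-- The time derivative is an almost everywhere limit of difference quotients along a sequence. -/
theorem aestronglyMeasurable_of_hasDerivWithinAt (hab : a < b)
    (hf : ∀ s ∈ Icc a b, AEStronglyMeasurable (f s) μ) (ht : t ∈ Icc a b)
    (hd : ∀ x, HasDerivWithinAt (fun s => f s x) (f' t x) (Icc a b) t) :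
    AEStronglyMeasurable (f' t) μ := by
  have : (𝓝[Icc a b \ {t}] t).NeBot := by
    have := uniqueDiffOn_Icc hab t ht
    exact accPt_principal_iff_nhdsWithin.1 this.accPt
  obtain ⟨u, hu⟩ := exists_seq_tendsto (𝓝[Icc a b \ {t}] t)
  have hmem : ∀ᶠ i in atTop, u i ∈ Icc a b \ {t} := hu.eventually self_mem_nhdsWithin
  obtain ⟨N, hN⟩ := eventually_atTop.1 hmem
  refine aestronglyMeasurable_of_tendsto_ae atTop
    (f := fun i x => slope (fun s => f s x) t (u (i + N))) (fun i => ?_) ?_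
  · have hi := hN (i + N) (by lia)
    simp only [slope, vsub_eq_sub, smul_eq_mul]
    exact ((hf _ hi.1).sub (hf t ht)).const_mul _
  · refine .of_forall fun x => ?_
    exact ((hasDerivWithinAt_iff_tendsto_slope.1 (hd x)).comp hu).comp (tendsto_add_atTop_nat N)

/-- Differentiation under the integral sign on a closed interval, one-sided at the end points: the
difference quotients are bounded by `B` because of the mean value inequality. -/
theorem hasDerivWithinAt_integral_of_dominated {B : M → ℝ} (hB : Integrable B μ)
    (hf : ∀ s ∈ Icc a b, Integrable (f s) μ)
    (hd : ∀ s ∈ Icc a b, ∀ x, HasDerivWithinAt (fun s => f s x) (f' s x) (Icc a b) s)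
    (hle : ∀ s ∈ Icc a b, ∀ x, |f' s x| ≤ B x) (ht : t ∈ Icc a b) :
    HasDerivWithinAt (fun s => ∫ x, f s x ∂μ) (∫ x, f' t x ∂μ) (Icc a b) t := by
  rw [hasDerivWithinAt_iff_tendsto_slope]
  have key : Tendsto (fun s => ∫ x, slope (fun s => f s x) t s ∂μ) (𝓝[Icc a b \ {t}] t)
      (𝓝 (∫ x, f' t x ∂μ)) := by
    refine tendsto_integral_filter_of_dominated_convergence B ?_ ?_ hB ?_
    · filter_upwards [self_mem_nhdsWithin] with s hs
      simp only [slope, vsub_eq_sub, smul_eq_mul]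
      exact ((hf s hs.1).1.sub (hf t ht).1).const_mul _
    · filter_upwards [self_mem_nhdsWithin] with s hs
      refine .of_forall fun x => ?_
      have := (convex_Icc a b).norm_image_sub_le_of_norm_hasDerivWithin_le
        (f := fun s => f s x) (fun r hr => hd r hr x) (fun r hr => hle r hr x) ht hs.1
      have h0 : 0 < ‖s - t‖ := norm_pos_iff.2 (sub_ne_zero.2 hs.2)
      rw [slope, vsub_eq_sub, norm_smul, norm_inv, inv_mul_le_iff₀ h0, mul_comm]
      exact this
    · exact .of_forall fun x => hasDerivWithinAt_iff_tendsto_slope.1 (hd t ht x)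
  refine key.congr' ?_
  filter_upwards [self_mem_nhdsWithin] with s hs
  simp only [slope, vsub_eq_sub, smul_eq_mul]
  rw [integral_const_mul, integral_sub (hf s hs.1) (hf t ht)]

end DominatedDerivative

/-! ### Gradients of affine functions of the potential -/

section Gradient

variable {n : ℕ} {M : Type*} [TopologicalSpace M] [ChartedSpace (EuclideanSpace ℝ (Fin n)) M]

theorem differential_const_mul_add_const {φ : M → ℝ} {x : M}
    (h : MDifferentiableAt (𝓡 n) 𝓘(ℝ, ℝ) φ x) (c d : ℝ) :
    differential n (fun y => c * φ y + d) x = c • differential n φ x := by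
  have h1 := (h.hasMFDerivAt.const_smul c).add (hasMFDerivAt_const (I := 𝓡 n) d x)
  exact h1.mfderiv.trans (add_zero _)

theorem differential_const (c : ℝ) (x : M) : differential n (fun _ => c) x = 0 :=
  (hasMFDerivAt_const (I := 𝓡 n) c x).mfderiv

variable [RiemannianBundle (fun x : M => TangentSpace (𝓡 n) x)]

theorem grad_const_mul_add_const {φ : M → ℝ} {x : M}
    (h : MDifferentiableAt (𝓡 n) 𝓘(ℝ, ℝ) φ x) (c d : ℝ) :
    grad n (fun y => c * φ y + d) x = c • grad n φ x := by
  refine ext_inner_right ℝ fun w => ?_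
  rw [inner_grad, differential_const_mul_add_const h, real_inner_smul_left, inner_grad]
  rfl

theorem grad_const (c : ℝ) (x : M) : grad n (fun _ : M => c) x = 0 := by
  refine ext_inner_right ℝ fun w => ?_
  rw [inner_grad, differential_const, inner_zero_left]
  rfl

end Gradient

/-! ### Behaviour of the functionals under scaling -/

section Functionals

variable {M : Type*} [MeasurableSpace M] {μ : Measure M} {ρ ρ' θ : M → ℝ}

theorem mass_const_mul (c : ℝ) : mass μ (fun x => c * ρ x) = c * mass μ ρ :=
  integral_const_mul _ _

theorem momentum_affine (hρ : Integrable ρ μ) (hp : Integrable (fun x => θ x * ρ x) μ)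
    (c d e : ℝ) : momentum μ (fun x => e * ρ x) (fun x => c * θ x + d) =
      e * (c * momentum μ ρ θ + d * mass μ ρ) := by
  have : ∀ x, (c * θ x + d) * (e * ρ x) = e * c * (θ x * ρ x) + e * d * ρ x := fun x => by ring
  simp only [momentum, mass, this]
  rw [integral_add (hp.const_mul _) (hρ.const_mul _), integral_const_mul, integral_const_mul]
  ring

theorem scalingRate_affine (hρ : Integrable ρ μ) (hp : Integrable (fun x => θ x * ρ x) μ)
    (hm : mass μ ρ ≠ 0) (c d : ℝ) {e : ℝ} (he : e ≠ 0) :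
    scalingRate μ (fun x => e * ρ x) (fun x => c * θ x + d) = c * scalingRate μ ρ θ + d := by
  rw [scalingRate, scalingRate, momentum_affine hρ hp, mass_const_mul]
  field_simp

variable {n : ℕ} [TopologicalSpace M] [ChartedSpace (EuclideanSpace ℝ (Fin n)) M]
  [RiemannianBundle (fun x : M => TangentSpace (𝓡 n) x)]

theorem kinetic_affine (hθ : MDifferentiable (𝓡 n) 𝓘(ℝ, ℝ) θ) (c d e : ℝ) :
    kinetic n μ (fun x => e * ρ x) (fun x => c * θ x + d) = e * c ^ 2 * kinetic n μ ρ θ := by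
  rw [kinetic, kinetic, ← integral_const_mul]
  congr 1 with x
  rw [grad_const_mul_add_const (hθ x), norm_smul, mul_pow, Real.norm_eq_abs, sq_abs]
  ring

theorem HasDivergence.const_smul {X : ∀ x : M, TangentSpace (𝓡 n) x} {D : M → ℝ}
    (h : HasDivergence n μ X D) (c : ℝ) :
    HasDivergence n μ (fun x => c • X x) (fun x => c * D x) := fun φ hφ hb => by
  have : ∀ x, φ x * (c * D x) = c * (φ x * D x) := fun x => by ring
  simp only [this, map_smul, smul_eq_mul]
  rw [integral_const_mul, h φ hφ hb, integral_const_mul, mul_neg]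

/-- If `θ` represents `ρ'` at `ρ`, then `c θ + d` represents `e (c ρ' + d ρ)` at `e ρ`: the factor
`c` comes from a change of the speed, the constant `d` from the derivative of `log e` in time. -/
theorem IsPotential.affine (h : IsPotential n μ ρ ρ' θ) (hθ : MDifferentiable (𝓡 n) 𝓘(ℝ, ℝ) θ)
    (hρ : Integrable ρ μ) (hp : Integrable (fun x => θ x * ρ x) μ) (hm : mass μ ρ ≠ 0)
    (c d : ℝ) {e : ℝ} (he : e ≠ 0) :
    IsPotential n μ (fun x => e * ρ x) (fun x => e * (c * ρ' x + d * ρ x))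
      (fun x => c * θ x + d) := by
  have := HasDivergence.const_smul h (e * c)
  unfold IsPotential
  convert this using 2 with x x
  · rw [grad_const_mul_add_const (hθ x), smul_smul, smul_smul]
    congr 1
    ring
  · rw [scalingRate_affine hρ hp hm c d he]
    ring

/-- Testing the continuity equation against the constant function `1`. -/
theorem IsPotential.integral_eq_momentum (h : IsPotential n μ ρ ρ' θ) (hρ : Integrable ρ μ)
    (hρ' : Integrable ρ' μ) (hm : mass μ ρ ≠ 0) : ∫ x, ρ' x ∂μ = momentum μ ρ θ := by
  have h1 := h (fun _ => 1) contMDiff_const ⟨1, fun x => by simp [grad_const]⟩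
  have h2 : ∀ x, differential n (fun _ : M => (1 : ℝ)) x (ρ x • grad n θ x) = 0 := fun x => by
    rw [differential_const]; rfl
  simp only [h2, one_mul, integral_zero, neg_zero] at h1
  rw [integral_sub (hρ.const_mul _) hρ', integral_const_mul] at h1
  have h3 : scalingRate μ ρ θ * mass μ ρ = momentum μ ρ θ := div_mul_cancel₀ _ hm
  rw [mass] at h3
  linarith

theorem metricSq_eq_two_mul_hamiltonian (hρ : Integrable ρ μ)
    (hK : Integrable (fun x => ‖grad n θ x‖ ^ 2 * ρ x) μ) (hm : mass μ ρ ≠ 0) :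
    metricSq n μ ρ θ = 2 * hamiltonian n μ ρ θ := by
  simp only [metricSq, add_mul]
  rw [integral_add hK (hρ.const_mul _), integral_const_mul, hamiltonian, scalingRate]
  change kinetic n μ ρ θ + _ * mass μ ρ = _
  field_simp

end Functionals

/-! ### Smoothness of slices and of reparametrized paths -/

section Paths

variable {n : ℕ} {M : Type*} [TopologicalSpace M] [ChartedSpace (EuclideanSpace ℝ (Fin n)) M]

section Slices

variable {k : ℕ∞} {a b : ℝ} {f : ℝ → M → ℝ}

theorem contDiffOn_slice_left (hf : ContMDiffOn (𝓘(ℝ, ℝ).prod (𝓡 n)) 𝓘(ℝ, ℝ) k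
    (fun p : ℝ × M => f p.1 p.2) (Icc a b ×ˢ univ)) (x : M) :
    ContDiffOn ℝ k (fun t => f t x) (Icc a b) :=
  contMDiffOn_iff_contDiffOn.1 <| hf.comp (f := fun t : ℝ => (t, x))
    (contMDiff_id.prodMk contMDiff_const).contMDiffOn fun _ ht => ⟨ht, mem_univ _⟩

theorem contMDiff_slice_right (hf : ContMDiffOn (𝓘(ℝ, ℝ).prod (𝓡 n)) 𝓘(ℝ, ℝ) k
    (fun p : ℝ × M => f p.1 p.2) (Icc a b ×ˢ univ)) {t : ℝ} (ht : t ∈ Icc a b) :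
    ContMDiff (𝓡 n) 𝓘(ℝ, ℝ) k (f t) :=
  contMDiffOn_univ.1 <| hf.comp (f := fun x : M => (t, x))
    (contMDiff_const.prodMk contMDiff_id).contMDiffOn fun _ _ => ⟨ht, mem_univ _⟩

/-- Smoothness of `c(q) f(τ(q), x) + d(q)`, where `q` ranges over a set of parameters: this is used
with `q = t` for paths and with `q = (ε, t)` for variations. -/
theorem contMDiffOn_reparam {E : Type*} [NormedAddCommGroup E] [NormedSpace ℝ E] {S : Set E}
    (hf : ContMDiffOn (𝓘(ℝ, ℝ).prod (𝓡 n)) 𝓘(ℝ, ℝ) k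
      (fun p : ℝ × M => f p.1 p.2) (Icc a b ×ˢ univ)) {τ c d : E → ℝ}
    (hτ : ContDiff ℝ ∞ τ) (hc : ContDiff ℝ ∞ c) (hd : ContDiff ℝ ∞ d)
    (hmaps : MapsTo τ S (Icc a b)) :
    ContMDiffOn (𝓘(ℝ, E).prod (𝓡 n)) 𝓘(ℝ, ℝ) k
      (fun p : E × M => c p.1 * f (τ p.1) p.2 + d p.1) (S ×ˢ univ) := by
  have hk : (k : WithTop ℕ∞) ≤ (⊤ : ℕ∞) := mod_cast le_top
  have lift : ∀ {g : E → ℝ}, ContDiff ℝ ∞ g → ContMDiff (𝓘(ℝ, E).prod (𝓡 n)) 𝓘(ℝ, ℝ) k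
      (fun p : E × M => g p.1) := fun hg =>
    (hg.of_le hk).contMDiff.comp contMDiff_fst
  refine ((lift hc).contMDiffOn.mul ?_).add (lift hd).contMDiffOn
  exact hf.comp (f := fun p : E × M => (τ p.1, p.2))
    ((lift hτ).prodMk contMDiff_snd).contMDiffOn fun p hp => ⟨hmaps hp.1, mem_univ _⟩

end Slices

variable [RiemannianBundle (fun x : M => TangentSpace (𝓡 n) x)] [MeasurableSpace M]
  {μ : Measure M} {k : ℕ∞} {a b : ℝ} {ρ θ : ℝ → M → ℝ}

/-! ### Paths of volume forms -/

namespace IsPath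

theorem hasDerivWithinAt (h : IsPath n k μ a b ρ θ) (hk : 2 ≤ k) {t : ℝ} (ht : t ∈ Icc a b)
    (x : M) : HasDerivWithinAt (fun s => ρ s x) (timeDeriv a b ρ t x) (Icc a b) t :=
  hasDerivWithinAt_timeDeriv (by rintro rfl; simp at hk)
    (contDiffOn_slice_left h.contMDiffOn_density x) ht

theorem mdifferentiable_potential (h : IsPath n k μ a b ρ θ) (hk : 2 ≤ k) {t : ℝ}
    (ht : t ∈ Icc a b) : MDifferentiable (𝓡 n) 𝓘(ℝ, ℝ) (θ t) :=
  (contMDiff_slice_right h.contMDiffOn_potential ht).mdifferentiable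
    (by have : k ≠ 0 := by { rintro rfl; simp at hk }
        simpa using this)

variable [BorelSpace M]

theorem integrable_density (h : IsPath n k μ a b ρ θ) {t : ℝ}
    (ht : t ∈ Icc a b) : Integrable (ρ t) μ := by
  obtain ⟨B, hB, hle⟩ := h.dominated
  exact hB.mono' (contMDiff_slice_right h.contMDiffOn_density ht).continuous.aestronglyMeasurable
    (.of_forall fun x => (hle t ht x).1)

theorem mass_pos [NeZero μ] (h : IsPath n k μ a b ρ θ) {t : ℝ}
    (ht : t ∈ Icc a b) : 0 < mass μ (ρ t) := by
  rw [mass, integral_pos_iff_support_of_nonneg (fun x => (h.pos t ht x).le)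
    (h.integrable_density ht)]
  have : Function.support (ρ t) = univ := eq_univ_of_forall fun x => (h.pos t ht x).ne'
  rw [this]
  exact Measure.measure_univ_pos.2 (NeZero.ne μ)

theorem metricSq_eq [NeZero μ] (h : IsPath n k μ a b ρ θ) {t : ℝ} (ht : t ∈ Icc a b) :
    metricSq n μ (ρ t) (θ t) = 2 * hamiltonian n μ (ρ t) (θ t) :=
  metricSq_eq_two_mul_hamiltonian (h.integrable_density ht) (h.integrable_kinetic t ht)
    (h.mass_pos ht).ne'

/-- The total volume changes at the rate `∫ θ ϱ`. -/
theorem hasDerivWithinAt_mass [NeZero μ] (h : IsPath n k μ a b ρ θ) (hk : 2 ≤ k) (hab : a < b)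
    {t : ℝ} (ht : t ∈ Icc a b) :
    HasDerivWithinAt (fun s => mass μ (ρ s)) (momentum μ (ρ t) (θ t)) (Icc a b) t := by
  obtain ⟨B, hB, hle⟩ := h.dominated
  have hd := fun s hs x => h.hasDerivWithinAt hk (t := s) hs x
  have hi : Integrable (timeDeriv a b ρ t) μ := hB.mono'
    (aestronglyMeasurable_of_hasDerivWithinAt hab (fun s hs => (h.integrable_density hs).1) ht
      (hd t ht)) (.of_forall fun x => (hle t ht x).2)
  rw [← (h.isPotential t ht).integral_eq_momentum (h.integrable_density ht) hi (h.mass_pos ht).ne']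
  exact hasDerivWithinAt_integral_of_dominated hB (fun s hs => h.integrable_density hs) hd
    (fun s hs x => (hle s hs x).2) ht

theorem contDiffOn_mass [NeZero μ] (h : IsPath n k μ a b ρ θ) (hk : 2 ≤ k) (hab : a < b) :
    ContDiffOn ℝ 1 (fun t => mass μ (ρ t)) (Icc a b) := by
  have hd := fun t ht => h.hasDerivWithinAt_mass hk hab (t := t) ht
  have hu := uniqueDiffOn_Icc hab
  refine (contDiffOn_succ_iff_derivWithin (n := 0) hu).2
    ⟨fun t ht => (hd t ht).differentiableWithinAt, by simp, ?_⟩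
  exact (h.contDiffOn_momentum.of_le zero_le_one).congr fun t ht =>
    (hd t ht).derivWithin (hu t ht)

theorem contDiffOn_hamiltonian [NeZero μ] (h : IsPath n k μ a b ρ θ) (hk : 2 ≤ k) (hab : a < b) :
    ContDiffOn ℝ 1 (fun t => hamiltonian n μ (ρ t) (θ t)) (Icc a b) := by
  refine (contDiffOn_const.mul h.contDiffOn_kinetic).add (.mul (contDiffOn_const.div
    (contDiffOn_const.mul (h.contDiffOn_mass hk hab)) fun t ht => ?_)
    (h.contDiffOn_momentum.pow 2))
  exact (mul_pos two_pos (h.mass_pos ht)).ne'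

/-- Paths of volume forms are stable under a smooth change of time `τ` and multiplication by a
smooth positive function `e ^ c` of time: the potential becomes `τ' θ(τ) + c'`. -/
theorem reparam [NeZero μ] (h : IsPath n k μ a b ρ θ) (hk : 2 ≤ k) (hab : a < b)
    {τ c : ℝ → ℝ} (hτ : ContDiff ℝ ∞ τ) (hc : ContDiff ℝ ∞ c)
    (hmaps : MapsTo τ (Icc a b) (Icc a b)) :
    IsPath n k μ a b (fun t x => Real.exp (c t) * ρ (τ t) x)
      (fun t x => deriv τ t * θ (τ t) x + deriv c t) := by
  have hexp : ContDiff ℝ ∞ (fun t => Real.exp (c t)) := hc.exp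
  have hτ' : ContDiff ℝ ∞ (deriv τ) := (contDiff_infty_iff_deriv.1 hτ).2
  have hc' : ContDiff ℝ ∞ (deriv c) := (contDiff_infty_iff_deriv.1 hc).2
  have h1 : (1 : WithTop ℕ∞) ≤ (⊤ : ℕ∞) := by simp
  have htd : ∀ t ∈ Icc a b, timeDeriv a b (fun t x => Real.exp (c t) * ρ (τ t) x) t =
      fun x => Real.exp (c t) * (deriv τ t * timeDeriv a b ρ (τ t) x +
        deriv c t * ρ (τ t) x) := fun t ht => by
    ext x
    have d1 := ((hc.differentiable (by simp)) t).hasDerivAt.exp.hasDerivWithinAt (s := Icc a b)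
    have d2 := (h.hasDerivWithinAt hk (hmaps ht) x).scomp t
      ((hτ.differentiable (by simp)) t).hasDerivAt.hasDerivWithinAt hmaps
    rw [timeDeriv]
    refine ((d1.mul d2).derivWithin (uniqueDiffOn_Icc hab t ht)).trans ?_
    simp only [Function.comp, smul_eq_mul]
    ring
  have hmom : ∀ t ∈ Icc a b, momentum μ (fun x => Real.exp (c t) * ρ (τ t) x)
      (fun x => deriv τ t * θ (τ t) x + deriv c t) = Real.exp (c t) *
        (deriv τ t * momentum μ (ρ (τ t)) (θ (τ t)) + deriv c t * mass μ (ρ (τ t))) :=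
    fun t ht => momentum_affine (h.integrable_density (hmaps ht))
      (h.integrable_momentum _ (hmaps ht)) _ _ _
  have hkin : ∀ t ∈ Icc a b, kinetic n μ (fun x => Real.exp (c t) * ρ (τ t) x)
      (fun x => deriv τ t * θ (τ t) x + deriv c t) =
        Real.exp (c t) * deriv τ t ^ 2 * kinetic n μ (ρ (τ t)) (θ (τ t)) :=
    fun t ht => kinetic_affine (h.mdifferentiable_potential hk (hmaps ht)) _ _ _
  refine ⟨fun t ht x => mul_pos (Real.exp_pos _) (h.pos _ (hmaps ht) x), ?_, ?_, ?_, ?_, ?_, ?_,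
    ?_, ?_⟩
  · simpa using contMDiffOn_reparam h.contMDiffOn_density hτ hexp (contDiff_const (c := 0)) hmaps
  · exact contMDiffOn_reparam h.contMDiffOn_potential hτ hτ' hc' hmaps
  · intro t ht
    rw [htd t ht]
    exact (h.isPotential _ (hmaps ht)).affine (h.mdifferentiable_potential hk (hmaps ht))
      (h.integrable_density (hmaps ht)) (h.integrable_momentum _ (hmaps ht))
      (h.mass_pos (hmaps ht)).ne' _ _ (Real.exp_ne_zero _)
  · obtain ⟨B, hB, hle⟩ := h.dominated
    have hcont : Continuous fun t => Real.exp (c t) * (|deriv τ t| + |deriv c t| + 1) :=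
      hexp.continuous.mul ((hτ'.continuous.abs.add hc'.continuous.abs).add continuous_const)
    obtain ⟨C, hC⟩ := isCompact_Icc.exists_bound_of_continuousOn (hcont.continuousOn (s := Icc a b))
    refine ⟨fun x => C * B x, hB.const_mul C, fun t ht x => ?_⟩
    obtain ⟨hr, hr'⟩ := hle _ (hmaps ht) x
    have hB0 : 0 ≤ B x := (abs_nonneg _).trans hr
    have hC1 : Real.exp (c t) * (|deriv τ t| + |deriv c t| + 1) ≤ C :=
      (le_abs_self _).trans (hC t ht)
    have he := Real.exp_pos (c t)
    have hn1 := abs_nonneg (deriv τ t)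
    have hn2 := abs_nonneg (deriv c t)
    constructor
    · rw [abs_mul, abs_of_pos he]
      exact mul_le_mul (by nlinarith) hr (abs_nonneg _) (le_trans (by positivity) hC1)
    · rw [htd t ht]
      dsimp only
      rw [abs_mul, abs_of_pos he]
      calc _ ≤ Real.exp (c t) * ((|deriv τ t| + |deriv c t| + 1) * B x) := by
            gcongr
            refine (abs_add_le _ _).trans ?_
            rw [abs_mul, abs_mul]
            nlinarith [mul_le_mul_of_nonneg_left hr' hn1, mul_le_mul_of_nonneg_left hr hn2]
        _ ≤ _ := by
            rw [← mul_assoc]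
            gcongr
  · intro t ht
    have := ((h.integrable_momentum _ (hmaps ht)).const_mul (Real.exp (c t) * deriv τ t)).add
      ((h.integrable_density (hmaps ht)).const_mul (Real.exp (c t) * deriv c t))
    refine this.congr (.of_forall fun x => ?_)
    simp only [Pi.add_apply]
    ring
  · intro t ht
    refine ((h.integrable_kinetic _ (hmaps ht)).const_mul
      (Real.exp (c t) * deriv τ t ^ 2)).congr (.of_forall fun x => ?_)
    dsimp only
    rw [grad_const_mul_add_const (h.mdifferentiable_potential hk (hmaps ht) x), norm_smul, mul_pow,
      Real.norm_eq_abs, sq_abs]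
    ring
  · have hτ1 := (hτ.of_le h1).contDiffOn (s := Icc a b)
    exact ((hexp.of_le h1).contDiffOn.mul
      (((hτ'.of_le h1).contDiffOn.mul (h.contDiffOn_momentum.comp hτ1 hmaps)).add
      ((hc'.of_le h1).contDiffOn.mul ((h.contDiffOn_mass hk hab).comp hτ1 hmaps)))).congr hmom
  · have hτ1 := (hτ.of_le h1).contDiffOn (s := Icc a b)
    exact (((hexp.of_le h1).contDiffOn.mul ((hτ'.of_le h1).contDiffOn.pow 2)).mul
      (h.contDiffOn_kinetic.comp hτ1 hmaps)).congr hkin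

end IsPath

end Paths

/-! ### Changes of time -/

section Diffeomorphisms

variable {a b δ : ℝ} {h : ℝ → ℝ}

theorem deriv_add_mul (hh : ContDiff ℝ ∞ h) (ε : ℝ) :
    deriv (fun t => t + ε * h t) = fun t => 1 + ε * deriv h t := by
  ext t
  exact ((hasDerivAt_id t).add
    (((hh.differentiable (by simp)) t).hasDerivAt.const_mul ε)).deriv

theorem strictMono_add_mul (hh : ContDiff ℝ ∞ h)
    (hδ : ∀ ε ∈ Ioo (-δ) δ, ∀ t, 0 < 1 + ε * deriv h t) {ε : ℝ} (hε : ε ∈ Ioo (-δ) δ) :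
    StrictMono fun t => t + ε * h t := by
  refine strictMono_of_deriv_pos fun t => ?_
  rw [deriv_add_mul hh]
  exact hδ ε hε t

/-- For small `ε` the map `t ↦ t + ε h(t)` is increasing, hence an admissible change of time. -/
theorem exists_forall_one_add_mul_deriv_pos (hh : ContDiff ℝ ∞ h) (hc : HasCompactSupport h) :
    ∃ δ > 0, ∀ ε ∈ Ioo (-δ) δ, ∀ t, 0 < 1 + ε * deriv h t := by
  obtain ⟨C, hC⟩ := hc.deriv.exists_bound_of_continuous (hh.continuous_deriv (by simp))
  have hC0 : 0 ≤ C := (norm_nonneg _).trans (hC 0)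
  refine ⟨1 / (C + 1), by positivity, fun ε hε t => ?_⟩
  have h1 : |ε| < 1 / (C + 1) := abs_lt.2 hε
  rw [lt_div_iff₀ (by positivity)] at h1
  have h2 : |ε * deriv h t| < 1 := by
    rw [abs_mul]
    have := hC t
    rw [Real.norm_eq_abs] at this
    nlinarith [mul_le_mul_of_nonneg_left this (abs_nonneg ε), abs_nonneg ε]
  linarith [(abs_lt.1 h2).1]

theorem mapsTo_Icc_add_mul (hh : ContDiff ℝ ∞ h) (ha : h a = 0) (hb : h b = 0)
    (hδ : ∀ ε ∈ Ioo (-δ) δ, ∀ t, 0 < 1 + ε * deriv h t) {ε : ℝ} (hε : ε ∈ Ioo (-δ) δ) :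
    MapsTo (fun t => t + ε * h t) (Icc a b) (Icc a b) := by
  have := (strictMono_add_mul hh hδ hε).monotone.mapsTo_Icc (a := a) (b := b)
  simpa only [ha, hb, mul_zero, add_zero] using this

theorem mapsTo_Ioo_add_mul (hh : ContDiff ℝ ∞ h) (ha : h a = 0) (hb : h b = 0)
    (hδ : ∀ ε ∈ Ioo (-δ) δ, ∀ t, 0 < 1 + ε * deriv h t) {ε : ℝ} (hε : ε ∈ Ioo (-δ) δ) :
    MapsTo (fun t => t + ε * h t) (Ioo a b) (Ioo a b) := by
  have := (strictMono_add_mul hh hδ hε).mapsTo_Ioo (a := a) (b := b)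
  simpa only [ha, hb, mul_zero, add_zero] using this

end Diffeomorphisms

/-! ### The first variation of the energy -/

section Lagrangian

variable {a b δ : ℝ} {H p m g g' h h' : ℝ → ℝ}

/-- The first variation of the energy, in terms of the functions of time `H = H(ϱ, θ)`,
`p = ∫ θ ϱ` and `m = ∫ ϱ` alone. For the path `e ^ (ε g) ϱ(τ)` with `τ = t + ε h`, whose potential
is `τ' θ(τ) + ε g'`, the Lagrangian is
`e ^ (ε g) (τ'² H(τ) + τ' p(τ) ε g' + (ε g')² m(τ) / 2)`. -/
theorem hasDerivAt_integral_exp_mul_lagrangian (hab : a < b) (hδ : 0 < δ)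
    (cH : ContDiffOn ℝ 1 H (Icc a b)) (cp : ContDiffOn ℝ 1 p (Icc a b))
    (cm : ContDiffOn ℝ 1 m (Icc a b)) (hg : Continuous g) (hg' : Continuous g')
    (hh : Continuous h) (hh' : Continuous h')
    (hmaps : ∀ ε ∈ Ioo (-δ) δ, MapsTo (fun t => t + ε * h t) (Icc a b) (Icc a b))
    (hmaps' : ∀ ε ∈ Ioo (-δ) δ, MapsTo (fun t => t + ε * h t) (Ioo a b) (Ioo a b)) :
    HasDerivAt (fun ε => ∫ t in a..b, Real.exp (ε * g t) *
        ((1 + ε * h' t) ^ 2 * H (t + ε * h t) + (1 + ε * h' t) * p (t + ε * h t) * (ε * g' t) +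
          (ε * g' t) ^ 2 * m (t + ε * h t) / 2))
      (∫ t in a..b, (g t * H t + g' t * p t +
        (2 * h' t * H t + h t * derivWithin H (Icc a b) t))) 0 := by
  have hu := uniqueDiffOn_Icc hab
  let G : ℝ → ℝ → ℝ := fun ε t => (1 + ε * h' t) ^ 2 * H (t + ε * h t) +
    (1 + ε * h' t) * p (t + ε * h t) * (ε * g' t) + (ε * g' t) ^ 2 * m (t + ε * h t) / 2
  let G' : ℝ → ℝ → ℝ := fun ε t =>
    2 * (1 + ε * h' t) * h' t * H (t + ε * h t) +
    (1 + ε * h' t) ^ 2 * (derivWithin H (Icc a b) (t + ε * h t) * h t) +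
    ((h' t * p (t + ε * h t) +
      (1 + ε * h' t) * (derivWithin p (Icc a b) (t + ε * h t) * h t)) * (ε * g' t) +
      (1 + ε * h' t) * p (t + ε * h t) * g' t) +
    (2 * (ε * g' t) * g' t * m (t + ε * h t) +
      (ε * g' t) ^ 2 * (derivWithin m (Icc a b) (t + ε * h t) * h t)) / 2
  have comp2 : ∀ {u : ℝ → ℝ}, ContinuousOn u (Icc a b) →
      ContinuousOn (fun q : ℝ × ℝ => u (q.2 + q.1 * h q.2)) (Ioo (-δ) δ ×ˢ Icc a b) :=
    fun hu => hu.comp (f := fun q : ℝ × ℝ => q.2 + q.1 * h q.2)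
      (Continuous.continuousOn (by fun_prop)) fun q hq => hmaps q.1 hq.1 hq.2
  have kH := comp2 cH.continuousOn
  have kp := comp2 cp.continuousOn
  have km := comp2 cm.continuousOn
  have kH' := comp2 (cH.continuousOn_derivWithin hu le_rfl)
  have kp' := comp2 (cp.continuousOn_derivWithin hu le_rfl)
  have km' := comp2 (cm.continuousOn_derivWithin hu le_rfl)
  have lift : ∀ {u : ℝ × ℝ → ℝ}, Continuous u → ContinuousOn u (Ioo (-δ) δ ×ˢ Icc a b) :=
    fun hu => hu.continuousOn
  have kh := lift (hh.comp continuous_snd)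
  have kh' := lift (hh'.comp continuous_snd)
  have kg := lift (hg.comp continuous_snd)
  have kg' := lift (hg'.comp continuous_snd)
  have kt : ContinuousOn (fun q : ℝ × ℝ => 1 + q.1 * h' q.2) (Ioo (-δ) δ ×ˢ Icc a b) :=
    lift (by fun_prop)
  have kc : ContinuousOn (fun q : ℝ × ℝ => q.1 * g' q.2) (Ioo (-δ) δ ×ˢ Icc a b) :=
    lift (by fun_prop)
  have ke : ContinuousOn (fun q : ℝ × ℝ => Real.exp (q.1 * g q.2)) (Ioo (-δ) δ ×ˢ Icc a b) :=
    lift (by fun_prop)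
  have kG : ContinuousOn (fun q : ℝ × ℝ => G q.1 q.2) (Ioo (-δ) δ ×ˢ Icc a b) :=
    (((kt.pow 2).mul kH).add ((kt.mul kp).mul kc)).add (((kc.pow 2).mul km).div_const 2)
  have kG' : ContinuousOn (fun q : ℝ × ℝ => G' q.1 q.2) (Ioo (-δ) δ ×ˢ Icc a b) :=
    (((((continuousOn_const.mul kt).mul kh').mul kH).add ((kt.pow 2).mul (kH'.mul kh))).add
      ((((kh'.mul kp).add (kt.mul (kp'.mul kh))).mul kc).add ((kt.mul kp).mul kg'))).add
      (((((continuousOn_const.mul kc).mul kg').mul km).add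
        ((kc.pow 2).mul (km'.mul kh))).div_const 2)
  have key := hasDerivAt_integral_of_continuousOn hab.le hδ
    (F := fun ε t => Real.exp (ε * g t) * G ε t)
    (F' := fun ε t => Real.exp (ε * g t) * g t * G ε t + Real.exp (ε * g t) * G' ε t)
    (fun ε hε => (ke.mul kG).comp (f := fun t => (ε, t)) (by fun_prop) fun t ht => ⟨hε, ht⟩)
    (((ke.mul kg).mul kG).add (ke.mul kG'))
    (fun ε hε t ht => by
      have hin := hmaps' ε hε ht
      have lin : ∀ c : ℝ, HasDerivAt (fun ε => ε * c) c ε := fun c => by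
        simpa using (hasDerivAt_id ε).mul_const c
      have dτ : HasDerivAt (fun ε => t + ε * h t) (h t) ε := (lin _).const_add t
      have dτ' : HasDerivAt (fun ε => 1 + ε * h' t) (h' t) ε := (lin _).const_add 1
      have dc := lin (g' t)
      have dcomp : ∀ {u : ℝ → ℝ}, ContDiffOn ℝ 1 u (Icc a b) →
          HasDerivAt (fun ε => u (t + ε * h t))
            (derivWithin u (Icc a b) (t + ε * h t) * h t) ε := fun hu =>
        (((hu.differentiableOn one_ne_zero) _ (Ioo_subset_Icc_self hin)).hasDerivWithinAt.hasDerivAt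
          (Icc_mem_nhds hin.1 hin.2)).comp ε dτ
      have dG : HasDerivAt (fun ε => G ε t) (G' ε t) ε := by
        refine ((((dτ'.pow 2).mul (dcomp cH)).add ((dτ'.mul (dcomp cp)).mul dc)).add
          (((dc.pow 2).mul (dcomp cm)).div_const 2)).congr_deriv ?_
        simp only [G', Pi.pow_apply, Pi.mul_apply]
        push_cast
        ring
      exact (lin (g t)).exp.mul dG)
  convert key using 1
  refine intervalIntegral.integral_congr fun t _ => ?_
  simp only [G, G', zero_mul, add_zero, Real.exp_zero]
  ring

end Lagrangian

section FirstVariation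

variable {n : ℕ} {M : Type*} [TopologicalSpace M] [ChartedSpace (EuclideanSpace ℝ (Fin n)) M]
  [RiemannianBundle (fun x : M => TangentSpace (𝓡 n) x)] [MeasurableSpace M] [BorelSpace M]
  {μ : Measure M} [NeZero μ] {k : ℕ∞} {a b : ℝ} {ρ θ : ℝ → M → ℝ} {g h : ℝ → ℝ} {δ : ℝ}

/-- Rescaling by `e ^ (ε g)` and the change of time `t + ε h` together give a variation with fixed
end points, for `g` and `h` that vanish at `a` and `b`. -/
theorem IsPath.isVariation_reparam (hP : IsPath n k μ a b ρ θ) (hk : 2 ≤ k) (hab : a < b)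
    (hg : ContDiff ℝ ∞ g) (hh : ContDiff ℝ ∞ h) (hga : g a = 0) (hgb : g b = 0)
    (hha : h a = 0) (hhb : h b = 0)
    (hδ : ∀ ε ∈ Ioo (-δ) δ, ∀ t, 0 < 1 + ε * deriv h t) :
    IsVariation n k μ a b ρ θ δ (fun ε t x => Real.exp (ε * g t) * ρ (t + ε * h t) x)
      (fun ε t x => (1 + ε * deriv h t) * θ (t + ε * h t) x + ε * deriv g t) := by
  have hg' : ContDiff ℝ ∞ (deriv g) := (contDiff_infty_iff_deriv.1 hg).2
  have hh' : ContDiff ℝ ∞ (deriv h) := (contDiff_infty_iff_deriv.1 hh).2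
  have hmaps : ∀ ε ∈ Ioo (-δ) δ, MapsTo (fun t => t + ε * h t) (Icc a b) (Icc a b) :=
    fun ε hε => mapsTo_Icc_add_mul hh hha hhb hδ hε
  have hmaps2 : MapsTo (fun q : ℝ × ℝ => q.2 + q.1 * h q.2) (Ioo (-δ) δ ×ˢ Icc a b) (Icc a b) :=
    fun q hq => hmaps q.1 hq.1 hq.2
  have hτ : ContDiff ℝ ∞ fun q : ℝ × ℝ => q.2 + q.1 * h q.2 := by fun_prop
  have hτ' : ContDiff ℝ ∞ fun q : ℝ × ℝ => 1 + q.1 * deriv h q.2 := by fun_prop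
  have hc : ContDiff ℝ ∞ fun q : ℝ × ℝ => Real.exp (q.1 * g q.2) := by fun_prop
  have hc' : ContDiff ℝ ∞ fun q : ℝ × ℝ => q.1 * deriv g q.2 := by fun_prop
  have h1 : (1 : WithTop ℕ∞) ≤ (⊤ : ℕ∞) := by simp
  have hτ1 := (hτ.of_le h1).contDiffOn (s := Ioo (-δ) δ ×ˢ Icc a b)
  have hm := (hP.contDiffOn_mass hk hab).comp hτ1 hmaps2
  have hp := hP.contDiffOn_momentum.comp hτ1 hmaps2
  refine ⟨fun ε hε => ?_, ?_, ?_, ?_, ?_, ?_, ?_, ?_, ?_, ?_⟩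
  · have := hP.reparam hk hab (τ := fun t => t + ε * h t) (c := fun t => ε * g t)
      (by fun_prop) (by fun_prop) (hmaps ε hε)
    rw [deriv_add_mul hh] at this
    have hd : deriv (fun t => ε * g t) = fun t => ε * deriv g t := by
      ext t
      exact (((hg.differentiable (by simp)) t).hasDerivAt.const_mul ε).deriv
    rwa [hd] at this
  · intro t _
    simp
  · intro t _
    simp
  · intro ε _
    simp [hga, hha]
  · intro ε _
    simp [hgb, hhb]
  · simpa using contMDiffOn_reparam hP.contMDiffOn_density hτ hc (contDiff_const (c := 0)) hmaps2
  · exact contMDiffOn_reparam hP.contMDiffOn_potential hτ hτ' hc' hmaps2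
  · exact ((hc.of_le h1).contDiffOn.mul hm).congr fun q _ => mass_const_mul _
  · exact ((hc.of_le h1).contDiffOn.mul (((hτ'.of_le h1).contDiffOn.mul hp).add
      ((hc'.of_le h1).contDiffOn.mul hm))).congr fun q hq =>
        momentum_affine (hP.integrable_density (hmaps2 hq))
          (hP.integrable_momentum _ (hmaps2 hq)) _ _ _
  · exact (((hc.of_le h1).contDiffOn.mul ((hτ'.of_le h1).contDiffOn.pow 2)).mul
      (hP.contDiffOn_kinetic.comp hτ1 hmaps2)).congr fun q hq =>
        kinetic_affine (hP.mdifferentiable_potential hk (hmaps2 hq)) _ _ _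

/-- The stationarity of the energy under rescaling and change of time. -/
theorem IsGeodesic.integral_eq_zero (hG : IsGeodesic n k μ a b ρ θ) (hk : 2 ≤ k) (hab : a < b)
    (hg : ContDiff ℝ ∞ g) (hh : ContDiff ℝ ∞ h) (hga : g a = 0) (hgb : g b = 0)
    (hha : h a = 0) (hhb : h b = 0) (hc : HasCompactSupport h) :
    ∫ t in a..b, (g t * hamiltonian n μ (ρ t) (θ t) + deriv g t * momentum μ (ρ t) (θ t) +
      (2 * deriv h t * hamiltonian n μ (ρ t) (θ t) +
        h t * derivWithin (fun s => hamiltonian n μ (ρ s) (θ s)) (Icc a b) t)) = 0 := by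
  obtain ⟨δ, hδ0, hδ⟩ := exists_forall_one_add_mul_deriv_pos hh hc
  obtain ⟨hP, hcrit⟩ := hG
  have hV := hP.isVariation_reparam hk hab hg hh hga hgb hha hhb hδ
  have hE := hcrit δ _ _ hδ0 hV
  set H : ℝ → ℝ := fun s => hamiltonian n μ (ρ s) (θ s) with hH
  set p : ℝ → ℝ := fun s => momentum μ (ρ s) (θ s) with hp
  set m : ℝ → ℝ := fun s => mass μ (ρ s) with hm
  have hmaps : ∀ ε ∈ Ioo (-δ) δ, MapsTo (fun t => t + ε * h t) (Icc a b) (Icc a b) :=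
    fun ε hε => mapsTo_Icc_add_mul hh hha hhb hδ hε
  have hmaps' : ∀ ε ∈ Ioo (-δ) δ, MapsTo (fun t => t + ε * h t) (Ioo a b) (Ioo a b) :=
    fun ε hε => mapsTo_Ioo_add_mul hh hha hhb hδ hε
  -- half the metric of the varied path, by the transformation rules of mass, momentum and energy
  have hlag : ∀ ε ∈ Ioo (-δ) δ,
      energy n μ a b (fun t x => Real.exp (ε * g t) * ρ (t + ε * h t) x)
        (fun t x => (1 + ε * deriv h t) * θ (t + ε * h t) x + ε * deriv g t) =
      ∫ t in a..b, Real.exp (ε * g t) * ((1 + ε * deriv h t) ^ 2 * H (t + ε * h t) +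
        (1 + ε * deriv h t) * p (t + ε * h t) * (ε * deriv g t) +
        (ε * deriv g t) ^ 2 * m (t + ε * h t) / 2) := fun ε hε => by
    rw [energy, ← intervalIntegral.integral_const_mul]
    refine intervalIntegral.integral_congr fun t ht => ?_
    rw [uIcc_of_le hab.le] at ht
    have ht' := hmaps ε hε ht
    have hmne := (hP.mass_pos ht').ne'
    have he := Real.exp_ne_zero (ε * g t)
    rw [(hV.isPath ε hε).metricSq_eq ht, hamiltonian, mass_const_mul,
      momentum_affine (hP.integrable_density ht') (hP.integrable_momentum _ ht'),
      kinetic_affine (hP.mdifferentiable_potential hk ht')]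
    simp only [hH, hp, hm, hamiltonian]
    field_simp
    ring
  have key := hasDerivAt_integral_exp_mul_lagrangian hab hδ0 (hP.contDiffOn_hamiltonian hk hab)
    hP.contDiffOn_momentum (hP.contDiffOn_mass hk hab) hg.continuous
    (hg.continuous_deriv (by simp)) hh.continuous (hh.continuous_deriv (by simp)) hmaps hmaps'
  refine key.unique (hE.congr_of_eventuallyEq ?_)
  filter_upwards [Ioo_mem_nhds (neg_lt_zero.2 hδ0) hδ0] with ε hε
  exact (hlag ε hε).symm

/-- Rescaling alone (`h = 0`) gives `∫ (g H + g' p) = 0` for all `g`, which is the weak form of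
`p' = H`. -/
theorem IsGeodesic.derivWithin_momentum (hG : IsGeodesic n k μ a b ρ θ) (hk : 2 ≤ k) (hab : a < b)
    {t : ℝ} (ht : t ∈ Icc a b) :
    derivWithin (fun s => momentum μ (ρ s) (θ s)) (Icc a b) t = hamiltonian n μ (ρ t) (θ t) := by
  have cH := (hG.1.contDiffOn_hamiltonian hk hab).continuousOn
  have cp := hG.1.contDiffOn_momentum
  have cp' := cp.continuousOn_derivWithin (uniqueDiffOn_Icc hab) le_rfl
  refine (sub_eq_zero.1 (eq_zero_of_forall_integral_mul_eq_zero hab (cH.sub cp')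
    (fun g hg _ hs => ?_) t ht)).symm
  obtain ⟨hga, hgb⟩ := eq_zero_of_tsupport_subset_Ioo hs
  have key := hG.integral_eq_zero hk hab hg (contDiff_const (c := 0)) hga hgb rfl rfl .zero
  have hgc := hg.continuous
  have hgc' := hg.continuous_deriv (by simp)
  have i1 : IntervalIntegrable (fun t => g t * hamiltonian n μ (ρ t) (θ t)) volume a b :=
    (hgc.continuousOn.mul cH).intervalIntegrable_of_Icc hab.le
  have i2 : IntervalIntegrable (fun t => momentum μ (ρ t) (θ t) * deriv g t) volume a b :=
    (cp.continuousOn.mul hgc'.continuousOn).intervalIntegrable_of_Icc hab.le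
  have i3 : IntervalIntegrable (fun t => g t *
      derivWithin (fun s => momentum μ (ρ s) (θ s)) (Icc a b) t) volume a b :=
    (hgc.continuousOn.mul cp').intervalIntegrable_of_Icc hab.le
  simp only [deriv_const, mul_zero, zero_mul, add_zero] at key
  simp only [mul_comm (deriv g _)] at key
  rw [intervalIntegral.integral_add i1 i2, integral_mul_deriv_of_tsupport_subset hab cp hg hs] at key
  simp only [Pi.sub_apply, mul_sub]
  rw [intervalIntegral.integral_sub i1 i3]
  linarith

/-- Change of time alone (`g = 0`) gives `∫ (2 h' H + h H') = 0` for all `h`. Integration by parts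
turns this into `∫ h H' = 0`. -/
theorem IsGeodesic.derivWithin_hamiltonian (hG : IsGeodesic n k μ a b ρ θ) (hk : 2 ≤ k)
    (hab : a < b) {t : ℝ} (ht : t ∈ Icc a b) :
    derivWithin (fun s => hamiltonian n μ (ρ s) (θ s)) (Icc a b) t = 0 := by
  have cH := hG.1.contDiffOn_hamiltonian hk hab
  have cH' := cH.continuousOn_derivWithin (uniqueDiffOn_Icc hab) le_rfl
  refine eq_zero_of_forall_integral_mul_eq_zero hab cH' (fun h hh hc hs => ?_) t ht
  obtain ⟨hha, hhb⟩ := eq_zero_of_tsupport_subset_Ioo hs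
  have key := hG.integral_eq_zero hk hab (contDiff_const (c := 0)) hh rfl rfl hha hhb hc
  have i1 : IntervalIntegrable (fun t => 2 * (hamiltonian n μ (ρ t) (θ t) * deriv h t))
      volume a b :=
    (continuousOn_const.mul (cH.continuousOn.mul
      (hh.continuous_deriv (by simp)).continuousOn)).intervalIntegrable_of_Icc hab.le
  have i2 : IntervalIntegrable (fun t => h t *
      derivWithin (fun s => hamiltonian n μ (ρ s) (θ s)) (Icc a b) t) volume a b :=
    (hh.continuous.continuousOn.mul cH').intervalIntegrable_of_Icc hab.le
  simp only [deriv_const, zero_mul, zero_add] at key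
  simp only [mul_assoc, mul_comm (deriv h _)] at key
  rw [intervalIntegral.integral_add i1 i2, intervalIntegral.integral_const_mul,
    integral_mul_deriv_of_tsupport_subset hab cH hh hs] at key
  linarith

end FirstVariation

end UnbalancedTransport

theorem mainTheorem3 {n : ℕ} {M : Type*} [TopologicalSpace M] [T2Space M]
    [SecondCountableTopology M] [ChartedSpace (EuclideanSpace ℝ (Fin n)) M]
    [IsManifold (𝓡 n) ∞ M] [RiemannianBundle (fun x : M => TangentSpace (𝓡 n) x)]
    [IsContMDiffRiemannianBundle (𝓡 n) ∞ (EuclideanSpace ℝ (Fin n))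
      (fun x : M => TangentSpace (𝓡 n) x)]
    [MeasurableSpace M] [BorelSpace M]
    (μ : Measure M) [IsProbabilityMeasure μ] (hμ : UnbalancedTransport.IsVolumeForm n μ)
    (k : ℕ∞) (hk : 2 ≤ k) (a b : ℝ) (hab : a < b) (ρ θ : ℝ → M → ℝ)
    (hgeo : UnbalancedTransport.IsGeodesic n k μ a b ρ θ) :
    -- the Hamiltonian is conserved
    (∀ t ∈ Icc a b, UnbalancedTransport.hamiltonian n μ (ρ t) (θ t) =
      UnbalancedTransport.hamiltonian n μ (ρ a) (θ a)) ∧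
    -- the total volume is differentiable, with derivative `∫ θ ϱ`
    (∀ t ∈ Icc a b, HasDerivWithinAt (fun s => UnbalancedTransport.mass μ (ρ s))
      (UnbalancedTransport.momentum μ (ρ t) (θ t)) (Icc a b) t) ∧
    -- its second derivative is the constant `H(ϱ(a), θ(a))`
    (∀ t ∈ Icc a b, HasDerivWithinAt (fun s => UnbalancedTransport.momentum μ (ρ s) (θ s))
      (UnbalancedTransport.hamiltonian n μ (ρ a) (θ a)) (Icc a b) t) ∧
    -- hence it moves like the height of an object in a constant gravity field
    (∀ t ∈ Icc a b, UnbalancedTransport.mass μ (ρ t) =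
      UnbalancedTransport.mass μ (ρ a) +
        UnbalancedTransport.momentum μ (ρ a) (θ a) * (t - a) +
        UnbalancedTransport.hamiltonian n μ (ρ a) (θ a) / 2 * (t - a) ^ 2) := by
  have hP := hgeo.1
  have cH := hP.contDiffOn_hamiltonian hk hab
  have h1 : ∀ t ∈ Icc a b, UnbalancedTransport.hamiltonian n μ (ρ t) (θ t) =
      UnbalancedTransport.hamiltonian n μ (ρ a) (θ a) :=
    UnbalancedTransport.eqOn_of_hasDerivWithinAt_eq (f' := fun _ => 0) (fun t ht => by
      rw [← hgeo.derivWithin_hamiltonian hk hab ht]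
      exact ((cH.differentiableOn one_ne_zero) t ht).hasDerivWithinAt)
      (fun t _ => hasDerivWithinAt_const _ _ _) rfl
  have h2 := fun t (ht : t ∈ Icc a b) => hP.hasDerivWithinAt_mass hk hab ht
  have h3 : ∀ t ∈ Icc a b, HasDerivWithinAt
      (fun s => UnbalancedTransport.momentum μ (ρ s) (θ s))
      (UnbalancedTransport.hamiltonian n μ (ρ a) (θ a)) (Icc a b) t := fun t ht => by
    rw [← h1 t ht, ← hgeo.derivWithin_momentum hk hab ht]
    exact ((hP.contDiffOn_momentum.differentiableOn one_ne_zero) t ht).hasDerivWithinAt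
  set H₀ := UnbalancedTransport.hamiltonian n μ (ρ a) (θ a)
  -- integrate twice: the momentum is affine, and then the mass is quadratic
  have hlin : ∀ c : ℝ, ∀ t, HasDerivWithinAt (fun s => c * (s - a)) c (Icc a b) t := fun c t => by
    simpa using (((hasDerivAt_id t).sub_const a).const_mul c).hasDerivWithinAt
  have h4 := UnbalancedTransport.eqOn_of_hasDerivWithinAt_eq
    (g := fun t => UnbalancedTransport.momentum μ (ρ a) (θ a) + H₀ * (t - a)) h3
    (fun t _ => (hlin H₀ t).const_add _) (by simp)
  refine ⟨h1, h2, h3, UnbalancedTransport.eqOn_of_hasDerivWithinAt_eq h2 (fun t ht => ?_)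
    (by simp)⟩
  rw [h4 t ht]
  have hq := (((hasDerivAt_id t).sub_const a).pow 2).const_mul (H₀ / 2)
  refine (((hlin _ t).const_add _).add hq.hasDerivWithinAt).congr_deriv ?_
  simp
  ring
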